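/- Let $\mathcal X$ be a non-empty finite set. A gamble on a set $Y$ is a bounded map $Y\to\mathbb R$; $\mathcal L(Y)$ is the linear space of all gambles on $Y$. A lower prevision $\underline P:\mathcal K\to\mathbb R$ on a linear space $\mathcal K\subseteq\mathcal L(Y)$ is coherent if $\sup_{y\in Y}\big[\sum_{k=1}^n\lambda_k(f_k(y)-\underline P(f_k))-\lambda_0(f_0(y)-\underline P(f_0))\big]\ge 0$ for all $n$, all $f_0,\dots,f_n\in\mathcal K$ and all real $\lambda_0,\dots,\lambda_n\ge0$. An exchangeable sequence $X_1,X_2,\dots$ in $\mathcal X$ is described by the distributions $\underline P^n$ of $(X_1,\dots,X_n)$, $n\ge1$. These are coherent lower previsions on $\mathcal L(\mathcal X^n)$ that are exchangeable, i.e. $\underline P^n(\pi f-f)\ge0$ for all $f\in\mathcal L(\mathcal X^n)$ and all permutations $\pi$ of $\{1,\dots,n\}$, where $(\pi f)(x)=f(x_{\pi(1)},\dots,x_{\pi(n)})$, and time consistent, i.e. for $n\le m$ and $f\in\mathcal L(\mathcal X^n)$, $\underline P^n(f)=\underline P^m(\tilde f)$ with $\tilde f(z_1,\dots,z_m)=f(z_1,\dots,z_n)$.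 Let $\Sigma_{\mathcal X}=\{\theta\in\mathbb R^{\mathcal X}:\theta_x\ge0,\ \sum_x\theta_x=1\}$ be the simplex, $\mathcal C(\Sigma_{\mathcal X})$ the space of continuous gambles on it, and, for $f\in\mathcal L(\mathcal X^n)$, let $\mathrm{Mn}^n(f|\theta)=\sum_{z\in\mathcal X^n}f(z)\prod_{x\in\mathcal X}\theta_x^{T_x(z)}$, where $T_x(z)$ is the number of components of $z$ equal to $x$. For a gamble $f$ on $\mathcal X$, let $S_{\mathcal X}(f|\theta)=\sum_{x\in\mathcal X}f(x)\theta_x$, and let $\underline P_{S_n(f)}$ be the distribution of the sample mean $S_n(f)=\frac1n\sum_{k=1}^nf(X_k)$, i.e. $\underline P_{S_n(f)}(h)=\underline P^n\big((z_1,\dots,z_n)\mapsto h(\tfrac1n\sum_{k=1}^n f(z_k))\big)$ for $h\in\mathcal L([\inf f,\sup f])$. Theorem. For every exchangeable sequence in $\mathcal X$ there is exactly one coherent lower prevision $\underline R$ on $\mathcal C(\Sigma_{\mathcal X})$ that represents it, i.e. $\underline P^n(f)=\underline R(\mathrm{Mn}^n(f|\cdot))$ for all $n\ge1$ and all $f\in\mathcal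 L(\mathcal X^n)$. Moreover, for every gamble $f$ on $\mathcal X$ and every continuous gamble $h$ on $[\inf f,\sup f]$, $$\lim_{n\to\infty}\underline P_{S_n(f)}(h)=\underline R\big(h(S_{\mathcal X}(f|\cdot))\big).$$ In particular, the sample means $S_n(f)$ converge in distribution, i.e. for every continuous gamble $h$ on $[\inf f,\sup f]$ the real numbers $\underline P_{S_n(f)}(h)$ converge. -/

import Mathlib

open Filter Topology

noncomputable section

namespace LowerPrev

/-- The linear space `ℒ(Y)` of gambles on `Y`: the bounded real-valued maps on `Y`. -/
def gambles (Y : Type*) : Submodule ℝ (Y → ℝ) where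
  carrier := {f | ∃ M : ℝ, ∀ y, |f y| ≤ M}
  zero_mem' := ⟨0, fun y => by simp⟩
  add_mem' := by
    rintro f g ⟨M, hM⟩ ⟨N, hN⟩
    exact ⟨M + N, fun y => (abs_add_le _ _).trans (add_le_add (hM y) (hN y))⟩
  smul_mem' := by
    rintro c f ⟨M, hM⟩
    refine ⟨|c| * M, fun y => ?_⟩
    rw [Pi.smul_apply, smul_eq_mul, abs_mul]
    exact mul_le_mul_of_nonneg_left (hM y) (abs_nonneg c)

/-- The linear space `𝒞(S)` of continuous gambles on `S`. -/
def continuousGambles (S : Type*) [TopologicalSpace S] : Submodule ℝ (S → ℝ) where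
  carrier := {h | Continuous h ∧ h ∈ gambles S}
  zero_mem' := ⟨continuous_const, (gambles S).zero_mem⟩
  add_mem' := fun hf hg => ⟨hf.1.add hg.1, (gambles S).add_mem hf.2 hg.2⟩
  smul_mem' := fun c _ hf => ⟨hf.1.const_smul c, (gambles S).smul_mem c hf.2⟩

/-- A continuous gamble, seen as a gamble. -/
def ofContinuous {S : Type*} [TopologicalSpace S] (h : continuousGambles S) : gambles S :=
  ⟨h.1, h.2.2⟩

/-- The gamble `h ∘ φ`. -/
def pull {Y Z : Type*} (φ : Y → Z) (h : gambles Z) : gambles Y :=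
  ⟨fun y => h.1 (φ y), h.2.imp fun _ hM y => hM (φ y)⟩

/-- The continuous gamble `h ∘ φ`, for a continuous map `φ`. -/
def pullContinuous {S T : Type*} [TopologicalSpace S] [TopologicalSpace T]
    (φ : C(S, T)) (h : continuousGambles T) : continuousGambles S :=
  ⟨fun s => h.1 (φ s), h.2.1.comp φ.continuous, (pull φ (ofContinuous h)).2⟩

/-- A lower prevision with domain `K`: a real-valued functional on `K`. -/
abbrev LowerPrevision {Y : Type*} (K : Submodule ℝ (Y → ℝ)) : Type _ := K → ℝ

/-- Coherence of a lower prevision `P` defined on a space `K` of gambles on `Y`: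
`sup_y [∑ₖ λₖ (fₖ(y) - P(fₖ)) - λ₀ (f₀(y) - P(f₀))] ≥ 0` for all `f₀, …, fₙ` in `K` and
all non-negative `λ₀, …, λₙ`. -/
def IsCoherent {Y : Type*} {K : Submodule ℝ (Y → ℝ)} (P : LowerPrevision K) : Prop :=
  K ≤ gambles Y ∧
    ∀ (n : ℕ) (f : Fin n → K) (f₀ : K) (c : Fin n → ℝ) (c₀ : ℝ), (∀ k, 0 ≤ c k) → 0 ≤ c₀ →
      0 ≤ ⨆ y : Y, (∑ k, c k * ((f k).1 y - P (f k)) - c₀ * (f₀.1 y - P f₀))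

/-- The distribution of `φ(X)`, when `P` is the distribution of `X`. -/
def induced {Y Z : Type*} (P : LowerPrevision (gambles Y)) (φ : Y → Z) :
    LowerPrevision (gambles Z) :=
  fun h => P (pull φ h)

/-- Exchangeability of (the joint distribution `P` of) `N` random variables in `X`:
`P(πf - f) ≥ 0` for every gamble `f` on `X^N` and every permutation `π` of the indices, where
`(πf)(x) = f(x_{π(1)}, …, x_{π(N)})`. -/
def IsExchangeable {X : Type*} {N : ℕ} (P : LowerPrevision (gambles (Fin N → X))) : Prop :=
  ∀ (π : Equiv.Perm (Fin N)) (f : gambles (Fin N → X)),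
    0 ≤ P (pull (fun x => x ∘ π) f - f)

/-- Time consistency: `Pⁿ` is the `Xⁿ`-marginal of `Pᵐ` whenever `n ≤ m`, that is, `Pⁿ(f)` is
`Pᵐ` of the cylindrical extension `(z₁, …, zₘ) ↦ f(z₁, …, zₙ)` of `f`. -/
def IsTimeConsistent {X : Type*} (P : ∀ n : ℕ+, LowerPrevision (gambles (Fin n → X))) : Prop :=
  ∀ (n m : ℕ+) (hnm : (n : ℕ) ≤ m) (f : gambles (Fin n → X)),
    P n f = P m (pull (fun z i => z (Fin.castLE hnm i)) f)

/-- `Pⁿ`, `n ≥ 1`, are the distributions of `(X₁, …, Xₙ)` for an exchangeable sequence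
`X₁, X₂, …` of random variables in `X`: a time consistent family of exchangeable coherent lower
previsions. -/
structure IsExchangeableSequence {X : Type*}
    (P : ∀ n : ℕ+, LowerPrevision (gambles (Fin n → X))) : Prop where
  coherent : ∀ n, IsCoherent (P n)
  exchangeable : ∀ n, IsExchangeable (P n)
  timeConsistent : IsTimeConsistent P

section Finite

variable {X : Type*} [Fintype X]

/-- `T_x(z)`: the number of components of the tuple `z` that assume the value `x`. -/
def count [DecidableEq X] {n : ℕ} (z : Fin n → X) (x : X) : ℕ :=
  (Finset.univ.filter fun k => z k = x).card

/-- The polynomial gamble `Mnⁿ(f|·)` on the simplex: `Mnⁿ(f|θ)` is the prevision of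
`f(Y₁, …, Yₙ)` for independent `Y₁, …, Yₙ` with probability mass function `θ`. -/
def multinomial [DecidableEq X] (n : ℕ) (f : gambles (Fin n → X)) :
    continuousGambles (stdSimplex ℝ X) :=
  ⟨fun θ => ∑ z : Fin n → X, f.1 z * ∏ x, θ.1 x ^ count z x, by
    have hc : Continuous fun θ : stdSimplex ℝ X =>
        ∑ z : Fin n → X, f.1 z * ∏ x, θ.1 x ^ count z x :=
      continuous_finsetSum _ fun z _ => continuous_const.mul <|
        continuous_finsetProd _ fun x _ =>
          ((continuous_apply x).comp continuous_subtype_val).pow _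
    refine ⟨hc, ?_⟩
    have : CompactSpace (stdSimplex ℝ X) :=
      isCompact_iff_compactSpace.1 (isCompact_stdSimplex ℝ X)
    obtain ⟨M, hM⟩ := isCompact_univ.exists_bound_of_continuousOn hc.continuousOn
    exact ⟨M, fun θ => hM θ (Set.mem_univ θ)⟩⟩

/-- `R`, defined on the continuous gambles on the simplex, is a representing lower prevision for
the family `Pⁿ`, `n ≥ 1`: it is coherent, and `Pⁿ(f) = R(Mnⁿ(f|·))`. -/
def IsRepresentation [DecidableEq X] (P : ∀ n : ℕ+, LowerPrevision (gambles (Fin n → X)))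
    (R : LowerPrevision (continuousGambles (stdSimplex ℝ X))) : Prop :=
  IsCoherent R ∧ ∀ (n : ℕ+) (f : gambles (Fin n → X)), P n f = R (multinomial n f)

/-- The interval `[inf f, sup f]`. -/
abbrev Range (f : gambles X) : Set ℝ := Set.Icc (⨅ x, f.1 x) (⨆ x, f.1 x)

lemma convexComb_mem (f : gambles X) {ι : Type*} (s : Finset ι) (g : ι → X) (w : ι → ℝ)
    (hw : ∀ i ∈ s, 0 ≤ w i) (hs : ∑ i ∈ s, w i = 1) :
    ∑ i ∈ s, f.1 (g i) * w i ∈ Range f := by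
  constructor
  · calc (⨅ x, f.1 x) = ∑ i ∈ s, (⨅ x, f.1 x) * w i := by rw [← Finset.mul_sum, hs, mul_one]
      _ ≤ _ := Finset.sum_le_sum fun i hi =>
        mul_le_mul_of_nonneg_right (ciInf_le (Set.finite_range f.1).bddBelow _) (hw i hi)
  · calc _ ≤ ∑ i ∈ s, (⨆ x, f.1 x) * w i := Finset.sum_le_sum fun i hi =>
        mul_le_mul_of_nonneg_right (le_ciSup (Set.finite_range f.1).bddAbove _) (hw i hi)
      _ = ⨆ x, f.1 x := by rw [← Finset.mul_sum, hs, mul_one]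

/-- The sample mean `Sₙ(f)(z) = (1/n) ∑ₖ f(zₖ)`, with values in `[inf f, sup f]`. -/
def sampleMean (f : gambles X) (n : ℕ+) (z : Fin n → X) : Range f :=
  ⟨1 / (n : ℝ) * ∑ k, f.1 (z k), by
    have hn : ((n : ℕ) : ℝ) ≠ 0 := by exact_mod_cast n.ne_zero
    have := convexComb_mem f Finset.univ z (fun _ => 1 / (n : ℝ))
      (fun _ _ => by positivity) (by simp [hn])
    rwa [← Finset.sum_mul, mul_comm] at this⟩

/-- The map `θ ↦ S_X(f|θ) = ∑ₓ f(x) θₓ` on the simplex, with values in `[inf f, sup f]`. -/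
def simplexMean (f : gambles X) : C(stdSimplex ℝ X, Range f) where
  toFun θ := ⟨∑ x, f.1 x * θ.1 x,
    convexComb_mem f Finset.univ id θ.1 (fun x _ => θ.2.1 x) θ.2.2⟩
  continuous_toFun := by
    exact Continuous.subtype_mk (continuous_finsetSum _ fun x _ =>
      continuous_const.mul ((continuous_apply x).comp continuous_subtype_val)) _

end Finite

/-- Convergence in distribution of random variables in a metric space `S` with distributions
`Qₙ`, `n ≥ 1`: for every continuous gamble `h` on `S`, the real numbers `Qₙ(h)` converge. -/
def ConvergesInDistribution {S : Type*} [MetricSpace S]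
    (Q : ℕ+ → LowerPrevision (gambles S)) : Prop :=
  ∀ h : continuousGambles S, ∃ l : ℝ, Tendsto (fun n => Q n (ofContinuous h)) atTop (𝓝 l)

end LowerPrev

end

/-!
A coherent lower prevision on a linear space is the same as a superlinear functional that dominates
the infimum, and such a functional is nonexpansive for the supremum distance.

For `z ∈ Xᵐ` let `empirical z` be the point of the simplex formed by the relative frequencies in
`z`, and let `Lₘ(g) = Pᵐ(g ∘ empirical)` be the law of the empirical distribution of
`X₁, …, Xₘ` (`empiricalLaw`). The value `Mnⁿ(f|empirical z)` is the average of `f(z ∘ φ)` over all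
maps `φ : Fin n → Fin m`: sampling with replacement from the urn `z` (`multinomial_empirical`).
By exchangeability, every injective `φ` is as good as the initial segment, for which
`Pᵐ(f(z ∘ φ)) = Pⁿ(f)` by time consistency. As the proportion of injective maps tends to one when
`m → ∞`, it follows that `Lₘ(Mnⁿ(f|·)) → Pⁿ(f)` (`tendsto_empiricalLaw_multinomial`).

The polynomial gambles `Mnⁿ(f|·)` are uniformly dense in the continuous gambles by the
Stone–Weierstrass theorem (`exists_multinomial_near`). Since the `Lₘ` are nonexpansive, `Lₘ(g)`
converges for every continuous gamble `g`, and the limit `R(g)` is coherent and represents the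
sequence. By density it is the only such functional. Finally, the sample mean is the value of
`S_X(f|·)` at the empirical distribution (`sampleMean_eq`), so the law of `Sₙ(f)` at `h` is
`Lₙ(h(S_X(f|·)))`, which converges to `R(h(S_X(f|·)))`.
-/

noncomputable section

namespace LowerPrev

/-! ### Coherence as superlinearity -/

/-- The functional form of coherence on a linear space: `P` dominates the infimum, is positively
homogeneous and is superadditive. The infimum is encoded through its lower bounds. -/
structure IsSuperlinear {Y : Type*} {K : Submodule ℝ (Y → ℝ)} (P : LowerPrevision K) : Prop where
  le_of_le : ∀ (f : K) (c : ℝ), (∀ y, c ≤ f.1 y) → c ≤ P f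
  smul : ∀ (c : ℝ) (f : K), 0 ≤ c → P (c • f) = c * P f
  add_le : ∀ f g : K, P f + P g ≤ P (f + g)

section Coherence

variable {Y : Type*} {K : Submodule ℝ (Y → ℝ)} {P : LowerPrevision K}

theorem IsCoherent.isSuperlinear [Nonempty Y] (hP : IsCoherent P) : IsSuperlinear P where
  le_of_le f c hc := by
    have h := hP.2 0 Fin.elim0 f Fin.elim0 1 (fun k => k.elim0) zero_le_one
    have h' : (⨆ y : Y, (∑ k : Fin 0, (Fin.elim0 k : ℝ) *
        ((Fin.elim0 k : K).1 y - P (Fin.elim0 k)) - 1 * (f.1 y - P f))) ≤ P f - c :=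
      ciSup_le fun y => by simpa using sub_le_sub_left (hc y) (P f)
    exact sub_nonneg.1 (h.trans h')
  smul c f hc := by
    apply le_antisymm
    · have h := hP.2 1 (fun _ => c • f) f (fun _ => 1) c (fun _ => zero_le_one) hc
      refine sub_nonneg.1 (h.trans (ciSup_le fun y => le_of_eq ?_))
      simp [mul_sub]
    · have h := hP.2 1 (fun _ => f) (c • f) (fun _ => c) 1 (fun _ => hc) zero_le_one
      refine sub_nonneg.1 (h.trans (ciSup_le fun y => le_of_eq ?_))
      simp [mul_sub]
  add_le f g := by
    have h := hP.2 2 ![f, g] (f + g) (fun _ => 1) 1 (fun _ => zero_le_one) zero_le_one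
    refine sub_nonneg.1 (h.trans (ciSup_le fun y => le_of_eq ?_))
    simp [Fin.sum_univ_two]

namespace IsSuperlinear

theorem map_zero (hP : IsSuperlinear P) : P 0 = 0 := by
  simpa using hP.smul 0 0 le_rfl

theorem sum_le (hP : IsSuperlinear P) {ι : Type*} (s : Finset ι) (f : ι → K) :
    ∑ i ∈ s, P (f i) ≤ P (∑ i ∈ s, f i) := by
  classical
  induction s using Finset.induction_on with
  | empty => simp [hP.map_zero]
  | insert i s hi ih =>
    rw [Finset.sum_insert hi, Finset.sum_insert hi]
    exact (add_le_add le_rfl ih).trans (hP.add_le _ _)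

theorem sub_le (hP : IsSuperlinear P) (f g : K) : P (f - g) ≤ P f - P g := by
  have := hP.add_le (f - g) g
  rw [sub_add_cancel] at this
  linarith

/-- A superlinear functional is nonexpansive for the supremum distance. -/
theorem abs_sub_le (hP : IsSuperlinear P) {f g : K} {ε : ℝ} (h : ∀ y, |f.1 y - g.1 y| ≤ ε) :
    |P f - P g| ≤ ε := by
  have h₁ := hP.le_of_le (f - g) (-ε) fun y => (abs_le.1 (h y)).1
  have h₂ := hP.le_of_le (g - f) (-ε) fun y => by
    have := (abs_le.1 (h y)).2
    change -ε ≤ g.1 y - f.1 y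
    linarith
  rw [abs_le]
  constructor <;> linarith [hP.sub_le f g, hP.sub_le g f]

theorem isCoherent [Nonempty Y] (hP : IsSuperlinear P) (hK : K ≤ gambles Y) : IsCoherent P := by
  refine ⟨hK, fun n f f₀ c c₀ hc hc₀ => ?_⟩
  set u : K := ∑ k, c k • f k - c₀ • f₀ with hu
  set a : ℝ := ∑ k, c k * P (f k) - c₀ * P f₀ with ha
  have hval : ∀ y, ∑ k, c k * ((f k).1 y - P (f k)) - c₀ * (f₀.1 y - P f₀) = u.1 y - a := by
    intro y
    have : u.1 y = ∑ k, c k * (f k).1 y - c₀ * f₀.1 y := by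
      simp [hu, Finset.sum_apply]
    rw [this, ha]
    simp only [mul_sub, Finset.sum_sub_distrib]
    ring
  simp only [hval]
  obtain ⟨M, hM⟩ := hK u.2
  have hbdd : BddAbove (Set.range fun y => u.1 y - a) :=
    ⟨M - a, by rintro _ ⟨y, rfl⟩; exact sub_le_sub_right (le_of_abs_le (hM y)) a⟩
  set s := ⨆ y, (u.1 y - a)
  -- `-u` is bounded below by `-(s + a)`, and `c₀ f₀ = ∑ cₖ fₖ + (-u)`
  have h₁ : -(s + a) ≤ P (-u) := hP.le_of_le _ _ fun y => by
    have : u.1 y - a ≤ s := le_ciSup hbdd y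
    change -(s + a) ≤ -u.1 y
    linarith
  have h₂ := hP.add_le (∑ k, c k • f k) (-u)
  have h₃ : ∑ k, c k * P (f k) ≤ P (∑ k, c k • f k) := by
    refine le_trans (le_of_eq ?_) (hP.sum_le _ _)
    exact Finset.sum_congr rfl fun k _ => (hP.smul _ _ (hc k)).symm
  rw [show ∑ k, c k • f k + -u = c₀ • f₀ by rw [hu]; abel, hP.smul _ _ hc₀] at h₂
  linarith

/-- Superlinearity passes to pointwise limits. -/
theorem of_tendsto {ι : Type*} {l : Filter ι} [l.NeBot] {L : ι → LowerPrevision K}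
    (hL : ∀ i, IsSuperlinear (L i)) (h : ∀ f, Tendsto (fun i => L i f) l (𝓝 (P f))) :
    IsSuperlinear P where
  le_of_le f c hc := ge_of_tendsto' (h f) fun i => (hL i).le_of_le f c hc
  smul c f hc := tendsto_nhds_unique (h (c • f)) <| by
    simpa only [(hL _).smul c f hc] using (h f).const_mul c
  add_le f g := le_of_tendsto_of_tendsto' ((h f).add (h g)) (h (f + g)) fun i =>
    (hL i).add_le f g

end IsSuperlinear

end Coherence

/-! ### Empirical distributions -/

section Finite

variable {X : Type*} [Fintype X] [DecidableEq X]

/-- Any real map on a finite set, as a gamble. -/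
def gambleOfFinite {Y : Type*} [Finite Y] (f : Y → ℝ) : gambles Y :=
  ⟨f, by
    obtain ⟨M, hM⟩ := (Set.finite_range fun y => |f y|).bddAbove
    exact ⟨M, fun y => hM ⟨y, rfl⟩⟩⟩

theorem multinomial_apply {n : ℕ} (f : gambles (Fin n → X)) (θ : stdSimplex ℝ X) :
    (multinomial n f).1 θ = ∑ z : Fin n → X, f.1 z * ∏ k, θ.1 (z k) := by
  refine Finset.sum_congr rfl fun z _ => ?_
  congr 1
  rw [← Finset.prod_fiberwise' Finset.univ z fun x => θ.1 x]
  exact Finset.prod_congr rfl fun x _ => by rw [Finset.prod_const, count]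

/-- The empirical distribution of the sample `z`: the point of the simplex with coordinates the
relative frequencies `T_x(z) / n`. -/
def empirical {n : ℕ+} (z : Fin n → X) : stdSimplex ℝ X :=
  ⟨fun x => count z x / (n : ℕ), fun x => by positivity, by
    have h := Finset.card_eq_sum_card_fiberwise (s := (Finset.univ : Finset (Fin n)))
      (t := Finset.univ) (f := z) (fun _ _ => Finset.mem_coe.2 (Finset.mem_univ _))
    rw [Finset.card_univ, Fintype.card_fin] at h
    rw [← Finset.sum_div, ← Nat.cast_sum]
    simp only [count, ← h]
    exact div_self (by exact_mod_cast n.ne_zero)⟩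

/-- The sample mean depends on the sample through its empirical distribution only. -/
theorem sampleMean_eq (f : gambles X) (n : ℕ+) (z : Fin n → X) :
    sampleMean f n z = simplexMean f (empirical z) := by
  apply Subtype.ext
  change 1 / (n : ℝ) * ∑ k, f.1 (z k) = ∑ x, f.1 x * ((count z x : ℝ) / (n : ℕ))
  rw [← Finset.sum_fiberwise' Finset.univ z fun x => f.1 x, Finset.mul_sum]
  refine Finset.sum_congr rfl fun x _ => ?_
  rw [Finset.sum_const, nsmul_eq_mul, count]
  ring

/-- Sampling `n` times with replacement from the urn `w` is sampling from its empirical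
distribution. -/
theorem multinomial_empirical {n : ℕ} {m : ℕ+} (f : gambles (Fin n → X)) (w : Fin m → X) :
    (multinomial n f).1 (empirical w) =
      ((m : ℝ) ^ n)⁻¹ * ∑ φ : Fin n → Fin m, f.1 (w ∘ φ) := by
  rw [multinomial_apply, ← Finset.sum_fiberwise' Finset.univ
    (fun φ : Fin n → Fin m => w ∘ φ) fun z => f.1 z, Finset.mul_sum]
  refine Finset.sum_congr rfl fun z _ => ?_
  have hcard : (Finset.univ.filter fun φ : Fin n → Fin m => w ∘ φ = z) =
      Fintype.piFinset fun k => Finset.univ.filter fun j => w j = z k := by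
    ext φ
    simp [funext_iff]
  rw [Finset.sum_const, nsmul_eq_mul, hcard, Fintype.card_piFinset]
  have : ∀ k, (empirical w).1 (z k) = ((Finset.univ.filter fun j => w j = z k).card : ℝ) / m :=
    fun k => rfl
  simp only [this, Finset.prod_div_distrib, Finset.prod_const, Finset.card_univ, Fintype.card_fin]
  push_cast
  ring

/-! ### Density of the multinomial polynomials -/

/-- The product of two polynomial gambles comes from the product gamble on the concatenated
sample. -/
theorem multinomial_mul {n m : ℕ} (f : gambles (Fin n → X)) (g : gambles (Fin m → X))
    (θ : stdSimplex ℝ X) :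
    (multinomial n f).1 θ * (multinomial m g).1 θ =
      (multinomial (n + m) (gambleOfFinite fun z =>
        f.1 (fun i => z (Fin.castAdd m i)) * g.1 (fun i => z (Fin.natAdd n i)))).1 θ := by
  simp only [multinomial_apply]
  rw [Finset.sum_mul_sum, ← Fintype.sum_prod_type',
    ← (Fin.appendEquiv n m).sum_comp]
  refine Finset.sum_congr rfl fun z _ => ?_
  simp only [gambleOfFinite, Fin.appendEquiv, Equiv.coe_fn_mk, Fin.prod_univ_add,
    Fin.append_left, Fin.append_right]
  ring

theorem multinomial_const (n : ℕ) (c : ℝ) (θ : stdSimplex ℝ X) :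
    (multinomial n (gambleOfFinite fun _ => c)).1 θ = c := by
  have h := Finset.prod_univ_sum (fun _ : Fin n => (Finset.univ : Finset X))
    fun _ x => θ.1 x
  rw [Fintype.piFinset_univ] at h
  rw [multinomial_apply]
  simp only [gambleOfFinite]
  rw [← Finset.mul_sum, ← h, θ.2.2]
  simp

theorem multinomial_add {n : ℕ} (f g : gambles (Fin n → X)) (θ : stdSimplex ℝ X) :
    (multinomial n (f + g)).1 θ = (multinomial n f).1 θ + (multinomial n g).1 θ := by
  simp only [multinomial_apply, ← Finset.sum_add_distrib, ← add_mul]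
  rfl

/-- The polynomial gambles `Mnⁿ(f|·)`, `n ≥ 1`, form a subalgebra of the continuous functions on
the simplex: sums and products are formed on the concatenation of the samples. -/
def multinomialSubalgebra (X : Type*) [Fintype X] [DecidableEq X] :
    Subalgebra ℝ C(stdSimplex ℝ X, ℝ) where
  carrier := {g | ∃ (n : ℕ+) (f : gambles (Fin n → X)), ∀ θ, g θ = (multinomial n f).1 θ}
  mul_mem' := by
    rintro a b ⟨n, f, hf⟩ ⟨m, g, hg⟩
    exact ⟨n + m, _, fun θ => by
      rw [ContinuousMap.mul_apply, hf, hg]; exact multinomial_mul f g θ⟩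
  add_mem' := by
    rintro a b ⟨n, f, hf⟩ ⟨m, g, hg⟩
    have hF := multinomial_mul f (gambleOfFinite fun _ : Fin m → X => 1)
    have hG := multinomial_mul (gambleOfFinite fun _ : Fin n → X => 1) g
    simp only [multinomial_const, mul_one, one_mul] at hF hG
    exact ⟨n + m, _, fun θ => by
      rw [ContinuousMap.add_apply, hf, hg, hF, hG]; exact (multinomial_add _ _ θ).symm⟩
  algebraMap_mem' c := ⟨1, gambleOfFinite fun _ => c, fun θ => (multinomial_const _ c θ).symm⟩

/-- By the Stone–Weierstrass theorem, every continuous gamble on the simplex is a uniform limit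
of polynomial gambles `Mnⁿ(f|·)`. -/
theorem exists_multinomial_near (g : continuousGambles (stdSimplex ℝ X)) {ε : ℝ} (hε : 0 < ε) :
    ∃ (n : ℕ+) (f : gambles (Fin n → X)), ∀ θ, |g.1 θ - (multinomial n f).1 θ| ≤ ε := by
  have : CompactSpace (stdSimplex ℝ X) :=
    isCompact_iff_compactSpace.1 (isCompact_stdSimplex ℝ X)
  have hsep : (multinomialSubalgebra X).SeparatesPoints := by
    intro θ θ' hne
    obtain ⟨x, hx⟩ := Function.ne_iff.1 (Subtype.coe_injective.ne hne)
    -- the coordinate `θ ↦ θ_x` is `Mn¹` of the indicator of `x`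
    let f : gambles (Fin (1 : ℕ+) → X) := gambleOfFinite fun z => if z 0 = x then 1 else 0
    have hf : ∀ η : stdSimplex ℝ X, (multinomial (1 : ℕ+) f).1 η = η.1 x := fun η => by
      rw [multinomial_apply]
      change ∑ z : Fin 1 → X, (if z 0 = x then (1 : ℝ) else 0) * ∏ k : Fin 1, η.1 (z k) = η.1 x
      rw [← (Equiv.funUnique (Fin 1) X).symm.sum_comp]
      simp
    refine ⟨_, ⟨⟨(multinomial (1 : ℕ+) f).1, (multinomial (1 : ℕ+) f).2.1⟩,
      ⟨1, f, fun _ => rfl⟩, rfl⟩, ?_⟩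
    simpa only [ContinuousMap.coe_mk, hf] using hx
  obtain ⟨⟨p, n, f, hf⟩, hp⟩ :=
    ContinuousMap.exists_mem_subalgebra_near_continuous_of_separatesPoints _ hsep g.1 g.2.1 ε hε
  refine ⟨n, f, fun θ => ?_⟩
  rw [← hf, abs_sub_comm]
  exact (hp θ).le

/-! ### Exchangeable samples and their empirical distributions -/

/-- A proportion tending to one of all maps `Fin n → Fin m` is injective. -/
theorem tendsto_descFactorial_div_pow (n : ℕ) :
    Tendsto (fun m : ℕ+ => ((m : ℕ).descFactorial n : ℝ) / (m : ℝ) ^ n) atTop (𝓝 1) := by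
  have h : Tendsto (fun m : ℕ => (((m : ℝ) - n) / m) ^ n) atTop (𝓝 1) := by
    have h1 : Tendsto (fun m : ℕ => 1 - (n : ℝ) / m) atTop (𝓝 1) := by
      simpa using (tendsto_const_div_atTop_nhds_zero_nat (n : ℝ)).const_sub 1
    have h2 := h1.pow n
    rw [one_pow] at h2
    refine h2.congr' ?_
    filter_upwards [eventually_gt_atTop 0] with m hm
    have : (m : ℝ) ≠ 0 := by exact_mod_cast hm.ne'
    rw [sub_div, div_self this]
  have hcoe : Tendsto (fun m : ℕ+ => (m : ℕ)) atTop atTop :=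
    tendsto_atTop_atTop.2 fun b => ⟨b.succPNat, fun m hm => (Nat.le_succ b).trans hm⟩
  refine tendsto_of_tendsto_of_tendsto_of_le_of_le' (h.comp hcoe) tendsto_const_nhds ?_ ?_
  · filter_upwards [hcoe.eventually_ge_atTop n] with m hm
    simp only [Function.comp_apply]
    rw [div_pow]
    gcongr
    calc ((m : ℝ) - n) ^ n ≤ (((m : ℕ) + 1 - n : ℕ) : ℝ) ^ n := by
          have hm' : (n : ℝ) ≤ (m : ℕ) := by exact_mod_cast hm
          refine pow_le_pow_left₀ (sub_nonneg.2 hm') ?_ n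
          rw [Nat.cast_sub (by omega)]
          push_cast
          linarith
      _ ≤ _ := by exact_mod_cast Nat.pow_sub_le_descFactorial (m : ℕ) n
  · filter_upwards with m
    refine div_le_one_of_le₀ ?_ (by positivity)
    exact_mod_cast Nat.descFactorial_le_pow (m : ℕ) n

/-- For an exchangeable distribution, selecting the components listed by an injective `φ` is as
good as selecting the first ones. -/
theorem IsExchangeable.nonneg_of_injective {X : Type*} {n m : ℕ}
    {Q : LowerPrevision (gambles (Fin m → X))}
    (hQ : IsExchangeable Q) (f : gambles (Fin n → X)) {φ ψ : Fin n → Fin m}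
    (hφ : φ.Injective) (hψ : ψ.Injective) :
    0 ≤ Q (pull (fun z => z ∘ φ) f - pull (fun z => z ∘ ψ) f) := by
  -- the two selections differ by a permutation `π` of the indices: `φ = π ∘ ψ`
  obtain ⟨π, rfl⟩ : ∃ π : Equiv.Perm (Fin m), π ∘ ψ = φ :=
    (Equiv.Perm.exists_extending_pair ψ φ hψ hφ).imp fun _ h => funext h
  exact hQ π (pull (fun z => z ∘ ψ) f)

variable {P : ∀ n : ℕ+, LowerPrevision (gambles (Fin n → X))}

/-- The distribution of the empirical distribution of the first `m` variables, on continuous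
gambles. -/
def empiricalLaw (P : ∀ n : ℕ+, LowerPrevision (gambles (Fin n → X))) (m : ℕ+) :
    LowerPrevision (continuousGambles (stdSimplex ℝ X)) :=
  fun g => P m (pull empirical (ofContinuous g))

theorem isSuperlinear_empiricalLaw [Nonempty X] (hP : IsExchangeableSequence P) (m : ℕ+) :
    IsSuperlinear (empiricalLaw P m) where
  le_of_le _ c hc := (hP.coherent m).isSuperlinear.le_of_le _ c fun z => hc (empirical z)
  smul c g hc := (hP.coherent m).isSuperlinear.smul c (pull empirical (ofContinuous g)) hc
  add_le _ _ := (hP.coherent m).isSuperlinear.add_le _ _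

/-- Sampling with and without replacement from the first `m` variables differ only on the
selections with repetitions, whose proportion is `1 - m(m-1)⋯(m-n+1) / mⁿ`. -/
theorem abs_sub_empiricalLaw_le [Nonempty X] (hP : IsExchangeableSequence P) {n m : ℕ+}
    (hnm : (n : ℕ) ≤ m) (f : gambles (Fin n → X)) {M : ℝ} (hM : ∀ z, |f.1 z| ≤ M) :
    |P n f - empiricalLaw P m (multinomial n f)| ≤
      2 * M * (1 - ((m : ℕ).descFactorial n : ℝ) / (m : ℝ) ^ (n : ℕ)) := by
  have hQ := (hP.coherent m).isSuperlinear
  let ι : Fin n → Fin m := Fin.castLE hnm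
  have hιinj : ι.Injective := Fin.castLE_injective hnm
  let F : (Fin n → Fin m) → gambles (Fin m → X) := fun φ => pull (fun z => z ∘ φ) f
  have hFle : ∀ φ z, |(F φ).1 z| ≤ M := fun φ z => hM (z ∘ φ)
  have hpow : (0 : ℝ) < (m : ℝ) ^ (n : ℕ) := by
    have : (0 : ℝ) < m := by exact_mod_cast m.pos
    positivity
  have hinj : ∑ φ : Fin n → Fin m, (if φ.Injective then (1 : ℝ) else 0) =
      (m : ℕ).descFactorial n := by
    rw [Finset.sum_boole, ← Fintype.card_subtype,
      Fintype.card_congr (Equiv.subtypeInjectiveEquivEmbedding _ _), Fintype.card_embedding_eq,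
      Fintype.card_fin, Fintype.card_fin]
  -- an average of gambles that are `≥ -2M` and almost all of which have non-negative prevision
  have key : ∀ u : (Fin n → Fin m) → gambles (Fin m → X), (∀ φ, φ.Injective → 0 ≤ P m (u φ)) →
      (∀ φ z, -(2 * M) ≤ (u φ).1 z) →
      -(2 * M * (1 - ((m : ℕ).descFactorial n : ℝ) / (m : ℝ) ^ (n : ℕ))) ≤
        P m (((m : ℝ) ^ (n : ℕ))⁻¹ • ∑ φ, u φ) := by
    intro u hu hu'
    have h : ∀ φ, -(2 * M) * (1 - if φ.Injective then (1 : ℝ) else 0) ≤ P m (u φ) := by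
      intro φ
      split_ifs with hφ
      · simpa using hu φ hφ
      · simpa using hQ.le_of_le _ _ (hu' φ)
    rw [hQ.smul _ _ (inv_nonneg.2 hpow.le)]
    refine le_trans (le_of_eq ?_) (mul_le_mul_of_nonneg_left
      ((Finset.sum_le_sum fun φ _ => h φ).trans (hQ.sum_le Finset.univ u)) (inv_nonneg.2 hpow.le))
    rw [← Finset.mul_sum, Finset.sum_sub_distrib, hinj, Finset.sum_const, Finset.card_univ,
      Fintype.card_fun, Fintype.card_fin, Fintype.card_fin, nsmul_eq_mul, mul_one, Nat.cast_pow]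
    field_simp
  have hlaw : empiricalLaw P m (multinomial n f) =
      P m (((m : ℝ) ^ (n : ℕ))⁻¹ • ∑ φ, F φ) := by
    refine congrArg (P m) (Subtype.ext (funext fun z => ?_))
    refine (multinomial_empirical f z).trans ?_
    simp [F, pull, Finset.sum_apply]
  have hconst : ((m : ℝ) ^ (n : ℕ))⁻¹ • ∑ _φ : Fin n → Fin m, F ι = F ι := by
    rw [Finset.sum_const, Finset.card_univ, Fintype.card_fun, Fintype.card_fin, Fintype.card_fin,
      ← Nat.cast_smul_eq_nsmul ℝ, smul_smul, Nat.cast_pow, inv_mul_cancel₀ hpow.ne', one_smul]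
  have h₁ := key (fun φ => F ι - F φ)
    (fun φ hφ => (hP.exchangeable m).nonneg_of_injective f hιinj hφ) fun φ z => by
      change _ ≤ (F ι).1 z - (F φ).1 z
      linarith [(abs_le.1 (hFle φ z)).2, (abs_le.1 (hFle ι z)).1]
  have h₂ := key (fun φ => F φ - F ι)
    (fun φ hφ => (hP.exchangeable m).nonneg_of_injective f hφ hιinj) fun φ z => by
      change _ ≤ (F φ).1 z - (F ι).1 z
      linarith [(abs_le.1 (hFle ι z)).2, (abs_le.1 (hFle φ z)).1]
  rw [Finset.sum_sub_distrib, smul_sub, hconst] at h₁ h₂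
  rw [hP.timeConsistent n m hnm f, hlaw]
  change |P m (F ι) - _| ≤ _
  rw [abs_le]
  constructor
  · linarith [hQ.sub_le (F ι) (((m : ℝ) ^ (n : ℕ))⁻¹ • ∑ φ, F φ)]
  · linarith [hQ.sub_le (((m : ℝ) ^ (n : ℕ))⁻¹ • ∑ φ, F φ) (F ι)]

theorem tendsto_empiricalLaw_multinomial [Nonempty X] (hP : IsExchangeableSequence P) (n : ℕ+)
    (f : gambles (Fin n → X)) :
    Tendsto (fun m => empiricalLaw P m (multinomial n f)) atTop (𝓝 (P n f)) := by
  obtain ⟨M, hM⟩ := f.2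
  have h0 : Tendsto (fun m : ℕ+ => 2 * M *
      (1 - ((m : ℕ).descFactorial n : ℝ) / (m : ℝ) ^ (n : ℕ))) atTop (𝓝 0) := by
    simpa using ((tendsto_descFactorial_div_pow n).const_sub 1).const_mul (2 * M)
  rw [tendsto_iff_dist_tendsto_zero]
  refine squeeze_zero' (Eventually.of_forall fun _ => dist_nonneg) ?_ h0
  filter_upwards [eventually_ge_atTop n] with m hm
  rw [dist_comm, Real.dist_eq]
  exact abs_sub_empiricalLaw_le hP hm f hM

/-- The laws of the empirical distributions converge: they do so on the dense set of polynomial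
gambles, and they are uniformly nonexpansive. -/
theorem exists_tendsto_empiricalLaw [Nonempty X] (hP : IsExchangeableSequence P)
    (g : continuousGambles (stdSimplex ℝ X)) :
    ∃ r, Tendsto (fun m => empiricalLaw P m g) atTop (𝓝 r) := by
  apply cauchySeq_tendsto_of_complete
  rw [Metric.cauchySeq_iff']
  intro ε hε
  obtain ⟨n, f, hf⟩ := exists_multinomial_near g (ε := ε / 5) (by positivity)
  have hc := (tendsto_empiricalLaw_multinomial hP n f).cauchySeq
  obtain ⟨N, hN⟩ := Metric.cauchySeq_iff'.1 hc (ε / 5) (by positivity)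
  refine ⟨N, fun m hm => ?_⟩
  have h₁ := abs_le.1 ((isSuperlinear_empiricalLaw hP m).abs_sub_le hf)
  have h₂ := abs_le.1 ((isSuperlinear_empiricalLaw hP N).abs_sub_le hf)
  have h₃ := abs_lt.1 (hN m hm)
  rw [Real.dist_eq, abs_lt]
  constructor <;> linarith [h₁.1, h₁.2, h₂.1, h₂.2, h₃.1, h₃.2]

/-- Two representing lower previsions agree on the dense set of polynomial gambles, and both are
nonexpansive. -/
theorem IsRepresentation.unique [Nonempty X]
    {R R' : LowerPrevision (continuousGambles (stdSimplex ℝ X))}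
    (hR : IsRepresentation P R) (hR' : IsRepresentation P R') : R = R' := by
  funext g
  refine eq_of_forall_dist_le fun ε hε => ?_
  obtain ⟨n, f, hf⟩ := exists_multinomial_near g (ε := ε / 2) (by positivity)
  have h₁ := abs_le.1 (hR.1.isSuperlinear.abs_sub_le hf)
  have h₂ := abs_le.1 (hR'.1.isSuperlinear.abs_sub_le hf)
  rw [← hR.2] at h₁
  rw [← hR'.2] at h₂
  rw [Real.dist_eq, abs_le]
  constructor <;> linarith [h₁.1, h₁.2, h₂.1, h₂.2]

end Finite

end LowerPrev

end

theorem mainTheorem5 {X : Type*} [Fintype X] [DecidableEq X] [Nonempty X]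
    (P : ∀ n : ℕ+, LowerPrev.LowerPrevision (LowerPrev.gambles (Fin n → X)))
    (hP : LowerPrev.IsExchangeableSequence P) :
    ∃ R : LowerPrev.LowerPrevision (LowerPrev.continuousGambles (stdSimplex ℝ X)),
      LowerPrev.IsRepresentation P R ∧
      (∀ R', LowerPrev.IsRepresentation P R' → R' = R) ∧
      ∀ f : LowerPrev.gambles X,
        (∀ h : LowerPrev.continuousGambles (LowerPrev.Range f),
          Tendsto
            (fun n : ℕ+ =>
              LowerPrev.induced (P n) (LowerPrev.sampleMean f n) (LowerPrev.ofContinuous h))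
            atTop
            (𝓝 (R (LowerPrev.pullContinuous (LowerPrev.simplexMean f) h)))) ∧
        LowerPrev.ConvergesInDistribution
          (fun n : ℕ+ => LowerPrev.induced (P n) (LowerPrev.sampleMean f n)) := by
  choose R hR using LowerPrev.exists_tendsto_empiricalLaw hP
  have hrep : LowerPrev.IsRepresentation P R :=
    ⟨(LowerPrev.IsSuperlinear.of_tendsto (LowerPrev.isSuperlinear_empiricalLaw hP) hR).isCoherent
        fun _ h => h.2,
      fun n f => tendsto_nhds_unique (LowerPrev.tendsto_empiricalLaw_multinomial hP n f) (hR _)⟩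
  have hlim : ∀ (f : LowerPrev.gambles X) (h : LowerPrev.continuousGambles (LowerPrev.Range f)),
      Tendsto (fun n : ℕ+ =>
        LowerPrev.induced (P n) (LowerPrev.sampleMean f n) (LowerPrev.ofContinuous h)) atTop
        (𝓝 (R (LowerPrev.pullContinuous (LowerPrev.simplexMean f) h))) := by
    intro f h
    convert hR (LowerPrev.pullContinuous (LowerPrev.simplexMean f) h) using 2 with n
    refine congrArg (P n) (Subtype.ext (funext fun z => ?_))
    exact congrArg h.1 (LowerPrev.sampleMean_eq f n z)
  exact ⟨R, hrep, fun R' hR' => hR'.unique hrep, fun f => ⟨hlim f, fun h => ⟨_, hlim f h⟩⟩⟩
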